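/- Let $E=(E^0,E^1,r,s)$ be a discrete graph, that is, sets $E^0$ (vertices) and $E^1$ (edges) of arbitrary cardinality with maps $r,s:E^1\to E^0$. A path of length $n\ge 1$ is a word $\alpha=\alpha_1\cdots\alpha_n$ of edges with $s(\alpha_i)=r(\alpha_{i+1})$ for $1\le i<n$; its range is $r(\alpha)=r(\alpha_1)$ and its source is $s(\alpha)=s(\alpha_n)$. It is a cycle if $r(\alpha)=s(\alpha)$, and a simple cycle if moreover $\alpha_i\neq\alpha_n$ for $1\le i<n$. The graph $E$ satisfies condition (K) if no vertex is the source of exactly one simple cycle. Let $C^*(E)$ be the graph $C^*$-algebra of $E$: the universal $C^*$-algebra generated by mutually orthogonal projections $p_v$ ($v\in E^0$) and elements $s_e$ ($e\in E^1$) such that $s_e^*s_e=p_{s(e)}$, $s_e^*s_f=0$ for $e\ne f$, $p_{r(e)}s_e=s_e$, and $p_v=\sum_{r(e)=v}s_es_e^*$ whenever $r^{-1}(v)$ is finite and non-empty. The gauge action $\gamma:\mathbb T\curvearrowright C^*(E)$ is determined by $\gamma_z(p_v)=p_v$ and $\gamma_z(s_e)=z s_e$. A tracial state on $C^*(E)$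 is a positive linear functional $\tau$ of norm one with $\tau(ab)=\tau(ba)$ for all $a,b\in C^*(E)$. If $E$ satisfies condition (K), then every tracial state $\tau$ on $C^*(E)$ is gauge invariant: $\tau(\gamma_z(a))=\tau(a)$ for all $z\in\mathbb T$ and $a\in C^*(E)$. -/

import Mathlib

open scoped ENNReal ComplexOrder

universe u v w

noncomputable section

/-- A discrete graph `E = (E⁰, E¹, r, s)`: arbitrary sets of vertices and of edges (of any
cardinality) with a range map and a source map. -/
structure DiscreteGraph : Type (max (u + 1) (v + 1)) where
  /-- the vertices -/
  V : Type u
  /-- the edges -/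
  Edge : Type v
  /-- the range of an edge -/
  r : Edge → V
  /-- the source of an edge -/
  s : Edge → V

namespace DiscreteGraph

/-! ### Paths, cycles and condition (K) -/

/-- The word `α₁ α₂ ⋯ αₙ` is a path: `s αᵢ = r αᵢ₊₁` for `1 ≤ i < n`. -/
def IsPath (E : DiscreteGraph.{u, v}) (α : List E.Edge) : Prop :=
  α.IsChain fun e f => E.s e = E.r f

/-- `α = α₁ ⋯ αₙ` is a path of length `n ≥ 1` with `s α = s αₙ = x` and `r α = r α₁ = x`, that is,
a cycle whose source is the vertex `x`. -/
def IsCycleAt (E : DiscreteGraph.{u, v}) (x : E.V) (α : List E.Edge) : Prop :=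
  E.IsPath α ∧ ∃ h : α ≠ [], E.s (α.getLast h) = x ∧ E.r (α.head h) = x

/-- `α = α₁ ⋯ αₙ` is a simple cycle with source `x`: a cycle with `αᵢ ≠ αₙ` for `1 ≤ i < n`. -/
def IsSimpleCycleAt (E : DiscreteGraph.{u, v}) (x : E.V) (α : List E.Edge) : Prop :=
  E.IsCycleAt x α ∧ ∀ h : α ≠ [], ∀ e ∈ α.dropLast, e ≠ α.getLast h

/-- Condition (K): no vertex is the source of a unique simple cycle. -/
def ConditionK (E : DiscreteGraph.{u, v}) : Prop :=
  ∀ x : E.V, ¬ ∃! α : List E.Edge, E.IsSimpleCycleAt x α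

/-! ### Cuntz–Krieger families -/

/-- A Cuntz–Krieger `E`-family in a C⋆-algebra `B`, in the convention where the edge `e` is
represented by a partial isometry from `p (s e)` to a subprojection of `p (r e)`. -/
structure CKFamily (E : DiscreteGraph.{u, v}) (B : Type w) [NonUnitalCStarAlgebra B] where
  /-- the vertex projections -/
  p : E.V → B
  /-- the edge partial isometries -/
  t : E.Edge → B
  star_p : ∀ x, star (p x) = p x
  p_mul_self : ∀ x, p x * p x = p x
  p_mul_p : ∀ x y, x ≠ y → p x * p y = 0
  star_t_mul_self : ∀ e, star (t e) * t e = p (E.s e)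
  star_t_mul_t : ∀ e f, e ≠ f → star (t e) * t f = 0
  p_mul_t : ∀ e, p (E.r e) * t e = t e
  sum_t_mul_star : ∀ (x : E.V) (h : (E.r ⁻¹' {x}).Finite), (E.r ⁻¹' {x}).Nonempty →
    ∑ e ∈ h.toFinset, t e * star (t e) = p x

namespace CKFamily

variable {E : DiscreteGraph.{u, v}} {B : Type w} [NonUnitalCStarAlgebra B]

theorem norm_p_le (F : E.CKFamily B) (x : E.V) : ‖F.p x‖ ≤ 1 := by
  have h : ‖F.p x‖ * ‖F.p x‖ = ‖F.p x‖ := by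
    rw [← CStarRing.norm_star_mul_self, F.star_p, F.p_mul_self]
  nlinarith [norm_nonneg (F.p x)]

theorem norm_t_le (F : E.CKFamily B) (e : E.Edge) : ‖F.t e‖ ≤ 1 := by
  have h : ‖F.t e‖ * ‖F.t e‖ = ‖F.p (E.s e)‖ := by
    rw [← CStarRing.norm_star_mul_self, F.star_t_mul_self]
  nlinarith [F.norm_p_le (E.s e), norm_nonneg (F.t e)]

/-- The family `(p, z t)` for `z` in the unit circle. -/
def twist (F : E.CKFamily B) (z : Circle) : E.CKFamily B where
  p := F.p
  t e := (z : ℂ) • F.t e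
  star_p := F.star_p
  p_mul_self := F.p_mul_self
  p_mul_p := F.p_mul_p
  star_t_mul_self e := by
    rw [star_smul, smul_mul_smul_comm, F.star_t_mul_self]
    simp [← Circle.coe_inv_eq_conj]
  star_t_mul_t e f h := by
    rw [star_smul, smul_mul_smul_comm, F.star_t_mul_t e f h, smul_zero]
  p_mul_t e := by rw [mul_smul_comm, F.p_mul_t]
  sum_t_mul_star x h hx := by
    rw [← F.sum_t_mul_star x h hx]
    refine Finset.sum_congr rfl fun e _ => ?_
    rw [star_smul, smul_mul_smul_comm]
    simp [← Circle.coe_inv_eq_conj]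

end CKFamily

/-! ### The graph C⋆-algebra

The universal C⋆-algebra generated by a Cuntz–Krieger `E`-family is the closed ⋆-subalgebra
generated by the canonical family in the `ℓ^∞`-product of all C⋆-algebras (in the universe of `E`)
that carry a Cuntz–Krieger `E`-family. The C⋆-subalgebra generated by a family has cardinality at
most `max (#E⁰, #E¹, 2^ℵ₀) ^ ℵ₀`, so that up to isomorphism this universe contains all of them. -/

/-- A C⋆-algebra together with a Cuntz–Krieger `E`-family in it. -/
structure CKRep (E : DiscreteGraph.{u, v}) : Type (max u v + 1) where
  /-- the C⋆-algebra -/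
  B : Type (max u v)
  [inst : NonUnitalCStarAlgebra B]
  /-- the family -/
  F : E.CKFamily B

attribute [instance] CKRep.inst

/-- The representation with the same C⋆-algebra and the family `(p, z t)`. -/
def CKRep.twist {E : DiscreteGraph.{u, v}} (i : E.CKRep) (z : Circle) : E.CKRep where
  B := i.B
  F := i.F.twist z

/-- The bounded families `(b_i)`, `b_i ∈ B_i`, indexed by all Cuntz–Krieger representations. -/
abbrev BigProd (E : DiscreteGraph.{u, v}) : Type (max u v + 1) :=
  lp (fun i : E.CKRep => i.B) ∞

/-- The family `(p_x)_i` over all representations `i`. -/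
def bigP (E : DiscreteGraph.{u, v}) (x : E.V) : E.BigProd :=
  ⟨fun i => i.F.p x, memℓp_infty ⟨1, by rintro _ ⟨i, rfl⟩; exact i.F.norm_p_le x⟩⟩

/-- The family `(t_e)_i` over all representations `i`. -/
def bigT (E : DiscreteGraph.{u, v}) (e : E.Edge) : E.BigProd :=
  ⟨fun i => i.F.t e, memℓp_infty ⟨1, by rintro _ ⟨i, rfl⟩; exact i.F.norm_t_le e⟩⟩

/-- The closed ⋆-subalgebra generated by the canonical family. -/
def cstarSubalgebra (E : DiscreteGraph.{u, v}) : NonUnitalStarSubalgebra ℂ E.BigProd :=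
  (NonUnitalStarAlgebra.adjoin ℂ (Set.range E.bigP ∪ Set.range E.bigT)).topologicalClosure

theorem isClosed_cstarSubalgebra (E : DiscreteGraph.{u, v}) :
    IsClosed (E.cstarSubalgebra : Set E.BigProd) :=
  NonUnitalStarSubalgebra.isClosed_topologicalClosure _

theorem bigP_mem (E : DiscreteGraph.{u, v}) (x : E.V) : E.bigP x ∈ E.cstarSubalgebra :=
  NonUnitalStarSubalgebra.le_topologicalClosure _
    (NonUnitalStarAlgebra.subset_adjoin ℂ _ (Or.inl ⟨x, rfl⟩))

theorem bigT_mem (E : DiscreteGraph.{u, v}) (e : E.Edge) : E.bigT e ∈ E.cstarSubalgebra :=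
  NonUnitalStarSubalgebra.le_topologicalClosure _
    (NonUnitalStarAlgebra.subset_adjoin ℂ _ (Or.inr ⟨e, rfl⟩))

/-- The graph C⋆-algebra `C⋆(E)`. -/
def GraphAlgebra (E : DiscreteGraph.{u, v}) : Type (max u v + 1) := E.cstarSubalgebra

instance (E : DiscreteGraph.{u, v}) : NonUnitalCStarAlgebra E.GraphAlgebra :=
  NonUnitalStarSubalgebra.nonUnitalCStarAlgebra E.cstarSubalgebra
    (h_closed := E.isClosed_cstarSubalgebra)

/-- The canonical (universal) Cuntz–Krieger family in `C⋆(E)`. -/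
def univFamily (E : DiscreteGraph.{u, v}) : E.CKFamily E.GraphAlgebra where
  p x := ⟨E.bigP x, E.bigP_mem x⟩
  t e := ⟨E.bigT e, E.bigT_mem e⟩
  star_p x := Subtype.ext <| lp.ext <| funext fun i => i.F.star_p x
  p_mul_self x := Subtype.ext <| lp.ext <| funext fun i => i.F.p_mul_self x
  p_mul_p x y h := Subtype.ext <| lp.ext <| funext fun i => i.F.p_mul_p x y h
  star_t_mul_self e := Subtype.ext <| lp.ext <| funext fun i => i.F.star_t_mul_self e
  star_t_mul_t e f h := Subtype.ext <| lp.ext <| funext fun i => i.F.star_t_mul_t e f h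
  p_mul_t e := Subtype.ext <| lp.ext <| funext fun i => i.F.p_mul_t e
  sum_t_mul_star x h hx := by
    refine Subtype.ext <| lp.ext <| funext fun i => ?_
    refine Eq.trans ?_ (i.F.sum_t_mul_star x h hx)
    have h1 : ∀ a : E.Edge → E.cstarSubalgebra,
        ((∑ e ∈ h.toFinset, a e : E.cstarSubalgebra) : E.BigProd) i =
          ∑ e ∈ h.toFinset, (a e : E.BigProd) i := by
      intro a
      rw [AddSubmonoidClass.coe_finsetSum, lp.coeFn_sum, Finset.sum_apply]
    exact h1 _

/-- Evaluation at the representation `i`: the ⋆-homomorphism `C⋆(E) → B_i` that exists by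
universality. -/
def GraphAlgebra.eval {E : DiscreteGraph.{u, v}} (i : E.CKRep) : E.GraphAlgebra →⋆ₙₐ[ℂ] i.B where
  toFun a := a.1 i
  map_smul' _ _ := rfl
  map_zero' := rfl
  map_add' _ _ := rfl
  map_mul' _ _ := rfl
  map_star' _ := rfl

theorem GraphAlgebra.eval_p {E : DiscreteGraph.{u, v}} (i : E.CKRep) (x : E.V) :
    GraphAlgebra.eval i (E.univFamily.p x) = i.F.p x := rfl

theorem GraphAlgebra.eval_t {E : DiscreteGraph.{u, v}} (i : E.CKRep) (e : E.Edge) :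
    GraphAlgebra.eval i (E.univFamily.t e) = i.F.t e := rfl

/-- `C⋆(E)` is generated as a C⋆-algebra by its canonical family. -/
theorem topologicalClosure_adjoin_univFamily (E : DiscreteGraph.{u, v}) :
    (NonUnitalStarAlgebra.adjoin ℂ
      (Set.range E.univFamily.p ∪ Set.range E.univFamily.t)).topologicalClosure = ⊤ := by
  set S := NonUnitalStarAlgebra.adjoin ℂ (Set.range E.univFamily.p ∪ Set.range E.univFamily.t)
  have emb : Topology.IsInducing (fun a : E.GraphAlgebra => (a.1 : E.BigProd)) := ⟨rfl⟩
  let φ : E.GraphAlgebra →⋆ₙₐ[ℂ] E.BigProd := NonUnitalStarSubalgebraClass.subtype E.cstarSubalgebra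
  rw [eq_top_iff]
  rintro a -
  show a ∈ closure (S : Set E.GraphAlgebra)
  rw [emb.closure_eq_preimage_closure_image]
  have h : NonUnitalStarAlgebra.adjoin ℂ (Set.range E.bigP ∪ Set.range E.bigT) ≤ S.map φ := by
    rw [NonUnitalStarAlgebra.adjoin_le_iff]
    rintro _ (⟨x, rfl⟩ | ⟨e, rfl⟩)
    · exact ⟨E.univFamily.p x, NonUnitalStarAlgebra.subset_adjoin ℂ _ (Or.inl ⟨x, rfl⟩), rfl⟩
    · exact ⟨E.univFamily.t e, NonUnitalStarAlgebra.subset_adjoin ℂ _ (Or.inr ⟨e, rfl⟩), rfl⟩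
  exact closure_mono h a.2

/-! ### The gauge action -/

/-- On the product, `γ_z` reindexes along `(p, t) ↦ (p, z t)`. -/
def bigTwist (E : DiscreteGraph.{u, v}) (z : Circle) : E.BigProd →⋆ₙₐ[ℂ] E.BigProd where
  toFun a := ⟨fun i => a (i.twist z), memℓp_infty ⟨‖a‖, by
    rintro _ ⟨i, rfl⟩
    exact lp.norm_apply_le_norm ENNReal.top_ne_zero a (i.twist z)⟩⟩
  map_smul' _ _ := rfl
  map_zero' := rfl
  map_add' _ _ := rfl
  map_mul' _ _ := rfl
  map_star' _ := rfl

theorem bigTwist_mem (E : DiscreteGraph.{u, v}) (z : Circle) {a : E.BigProd}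
    (ha : a ∈ E.cstarSubalgebra) : E.bigTwist z a ∈ E.cstarSubalgebra := by
  have hle : NonUnitalStarAlgebra.adjoin ℂ (Set.range E.bigP ∪ Set.range E.bigT) ≤
      E.cstarSubalgebra.comap (E.bigTwist z) := by
    rw [NonUnitalStarAlgebra.adjoin_le_iff]
    rintro _ (⟨x, rfl⟩ | ⟨e, rfl⟩)
    · exact E.bigP_mem x
    · exact SMulMemClass.smul_mem (z : ℂ) (E.bigT_mem e)
  have hcl : IsClosed ((E.cstarSubalgebra.comap (E.bigTwist z) :
      NonUnitalStarSubalgebra ℂ E.BigProd) : Set E.BigProd) :=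
    E.isClosed_cstarSubalgebra.preimage (AddMonoidHomClass.continuous_of_bound (E.bigTwist z) 1
      fun a => by simpa using NonUnitalStarAlgHom.norm_apply_le (E.bigTwist z) a)
  exact NonUnitalStarSubalgebra.topologicalClosure_minimal _ hle hcl ha

theorem twist_apply_eq {E : DiscreteGraph.{u, v}} (a : E.BigProd) {B : Type (max u v)}
    [NonUnitalCStarAlgebra B] {F F' : E.CKFamily B} (h : F.t = F'.t) (h' : F.p = F'.p) :
    a ⟨B, F⟩ = a ⟨B, F'⟩ := by
  cases F
  cases F'
  subst h
  subst h'
  rfl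

/-- The gauge action `γ : 𝕋 ↷ C⋆(E)`, determined by `γ_z (p_x) = p_x` and `γ_z (t_e) = z t_e`. -/
def gaugeAction (E : DiscreteGraph.{u, v}) :
    Circle →* (E.GraphAlgebra →⋆ₙₐ[ℂ] E.GraphAlgebra) where
  toFun z :=
    { toFun := fun a => ⟨E.bigTwist z a.1, E.bigTwist_mem z a.2⟩
      map_smul' := fun _ _ => rfl
      map_zero' := rfl
      map_add' := fun _ _ => rfl
      map_mul' := fun _ _ => rfl
      map_star' := fun _ => rfl }
  map_one' := by
    ext a
    refine Subtype.ext <| lp.ext <| funext fun i => ?_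
    exact twist_apply_eq a.1 (F := i.F.twist 1) (F' := i.F)
      (funext fun e => by simp [CKFamily.twist]) rfl
  map_mul' z w := by
    ext a
    refine Subtype.ext <| lp.ext <| funext fun i => ?_
    exact twist_apply_eq a.1 (F := i.F.twist (z * w)) (F' := (i.F.twist z).twist w)
      (funext fun e => by simp [CKFamily.twist, smul_smul, mul_comm]) rfl

theorem gaugeAction_p (E : DiscreteGraph.{u, v}) (z : Circle) (x : E.V) :
    E.gaugeAction z (E.univFamily.p x) = E.univFamily.p x := rfl

theorem gaugeAction_t (E : DiscreteGraph.{u, v}) (z : Circle) (e : E.Edge) :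
    E.gaugeAction z (E.univFamily.t e) = (z : ℂ) • E.univFamily.t e := rfl

end DiscreteGraph

/-! ### Tracial states -/

/-- A tracial state on a C⋆-algebra: a positive linear functional `τ` of norm one with
`τ (a b) = τ (b a)` for all `a` and `b`. -/
structure IsTracialState {A : Type w} [NonUnitalCStarAlgebra A] (τ : A →L[ℂ] ℂ) : Prop where
  nonneg : ∀ a, 0 ≤ τ (star a * a)
  norm_eq_one : ‖τ‖ = 1
  map_mul_comm : ∀ a b, τ (a * b) = τ (b * a)

end

namespace DiscreteGraph

/-! ### Cycles and condition (K) -/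

/-! The algebra is the closed span of monomials `t_μ p_x t_ν⋆`, and `γ_z` multiplies such a monomial
by `z` to the power `|μ| - |ν|`. So it suffices that a tracial state `τ` vanishes on monomials with
`|μ| ≠ |ν|`.

By the trace property, `τ (t_μ p_x t_ν⋆) = τ (p_x t_ν⋆ t_μ p_x)`. Cancelling common initial edges
shows that this product is zero unless one word extends the other, and what is left is then `p_x t_κ
p_x` or its adjoint with `κ` nonempty. This is nonzero only if `κ` is a cycle at `x`.

Condition (K) then supplies two distinct cycles at `x` of equal length, hence two orthogonal
subprojections of `p_x` equivalent to it. Thus `2 τ (p_x) ≤ τ (p_x)`, so `τ (p_x) = 0`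
(`ConditionK.tracial_map_p_eq_zero`), and by a Cauchy–Schwarz argument
(`IsTracialState.map_star_mul_eq_zero`) `τ` kills everything of the form `p_x b`. -/

theorem IsCycleAt.append {E : DiscreteGraph.{u, v}} {x : E.V} {α β : List E.Edge}
    (hα : E.IsCycleAt x α) (hβ : E.IsCycleAt x β) : E.IsCycleAt x (α ++ β) := by
  obtain ⟨hα, hα0, hαs, hαr⟩ := hα
  obtain ⟨hβ, hβ0, hβs, hβr⟩ := hβ
  refine ⟨List.IsChain.append hα hβ ?_, by simp [hα0], ?_, ?_⟩
  · intro e he f hf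
    rw [List.getLast?_eq_getLast_of_ne_nil hα0, Option.mem_some_iff] at he
    rw [List.head?_eq_some_head hβ0, Option.mem_some_iff] at hf
    subst he hf
    rw [hαs, hβr]
  · rw [List.getLast_append_of_ne_nil _ hβ0, hβs]
  · rw [List.head_append_of_ne_nil hα0, hαr]

/-- A vertex on a cycle is the source of a simple cycle. -/
theorem IsCycleAt.exists_isSimpleCycleAt {E : DiscreteGraph.{u, v}} {x : E.V} {α : List E.Edge}
    (hα : E.IsCycleAt x α) : ∃ β, E.IsSimpleCycleAt x β := by
  induction hn : α.length using Nat.strong_induction_on generalizing α with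
  | _ n ih =>
    by_cases hs : ∀ h : α ≠ [], ∀ e ∈ α.dropLast, e ≠ α.getLast h
    · exact ⟨α, hα, hs⟩
    · push Not at hs
      obtain ⟨h0, e, he, hel⟩ := hs
      -- The last edge `e` has source `x`, so cutting just after an earlier occurrence of `e` leaves
      -- a strictly shorter cycle at `x`.
      obtain ⟨l₁, l₂, hl⟩ := List.append_of_mem he
      have hsplit : α = (l₁ ++ [e]) ++ (l₂ ++ [e]) := by
        conv_lhs => rw [← List.dropLast_append_getLast h0, hl, ← hel]
        simp
      have hx : E.s e = x := by
        obtain ⟨-, _, h, -⟩ := hα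
        rw [hel, h]
      have hp : E.IsPath ((l₁ ++ [e]) ++ (l₂ ++ [e])) := hsplit ▸ hα.1
      have hp' := List.isChain_append.1 hp
      refine ih (l₂ ++ [e]).length ?_ (α := l₂ ++ [e]) ⟨hp'.2.1, by simp, by simpa using hx, ?_⟩ rfl
      · rw [← hn, hsplit]
        simp only [List.length_append, List.length_cons, List.length_nil]
        omega
      · rw [← hx]
        exact (hp'.2.2 e (by simp) _ (List.head?_eq_some_head (by simp))).symm

/-- If `α` were shorter, it would be a proper prefix of `β`. The two products end in the same edge,
so the last edge of `β` would already occur at the end of that prefix, against simplicity. -/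
theorem IsSimpleCycleAt.length_le_of_append_comm {E : DiscreteGraph.{u, v}} {x : E.V}
    {α β : List E.Edge} (hα : E.IsSimpleCycleAt x α) (hβ : E.IsSimpleCycleAt x β)
    (h : α ++ β = β ++ α) : β.length ≤ α.length := by
  by_contra! hlt
  obtain ⟨-, hα0, -⟩ := hα.1
  obtain ⟨-, hβ0, -⟩ := hβ.1
  obtain ⟨γ, rfl⟩ : α <+: β :=
    List.prefix_of_prefix_length_le (List.prefix_append α β) (h ▸ List.prefix_append β α) hlt.le
  have hγ : γ ≠ [] := by
    rintro rfl
    simp at hlt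
  refine hβ.2 hβ0 (α.getLast hα0) ?_ ?_
  · rw [List.dropLast_append_of_ne_nil hγ]
    exact List.mem_append_left _ (List.getLast_mem hα0)
  · have := congrArg List.getLast? h
    rw [List.getLast?_append_of_ne_nil _ hβ0, List.getLast?_append_of_ne_nil _ hα0,
      List.getLast?_eq_getLast_of_ne_nil hβ0, List.getLast?_eq_getLast_of_ne_nil hα0] at this
    exact (Option.some.inj this).symm

/-- Under condition (K), a vertex on a cycle is the source of two distinct cycles of the same
length. -/
theorem ConditionK.exists_isCycleAt_pair {E : DiscreteGraph.{u, v}} (hK : E.ConditionK) {x : E.V}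
    {α : List E.Edge} (hα : E.IsCycleAt x α) :
    ∃ β γ, E.IsCycleAt x β ∧ E.IsCycleAt x γ ∧ β.length = γ.length ∧ β ≠ γ := by
  obtain ⟨β, hβ⟩ := hα.exists_isSimpleCycleAt
  obtain ⟨γ, hγ, hne⟩ : ∃ γ, E.IsSimpleCycleAt x γ ∧ γ ≠ β := by
    by_contra! h
    exact hK x ⟨β, hβ, h⟩
  -- Concatenating in both orders equalizes the lengths; distinct simple cycles do not commute.
  refine ⟨β ++ γ, γ ++ β, hβ.1.append hγ.1, hγ.1.append hβ.1, by simp [add_comm], fun h => ?_⟩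
  have hlen := (hγ.length_le_of_append_comm hβ h.symm).antisymm (hβ.length_le_of_append_comm hγ h)
  exact hne (List.append_inj_left h hlen).symm

/-! ### Path monomials -/

namespace CKFamily

variable {E : DiscreteGraph.{u, v}} {B : Type w} [NonUnitalCStarAlgebra B]

/-- The product `t_{e₁} ⋯ t_{eₙ} p_x` for a word `e₁ ⋯ eₙ`. -/
def word (F : E.CKFamily B) (x : E.V) : List E.Edge → B
  | [] => F.p x
  | e :: μ => F.t e * F.word x μ

theorem p_mul_t_of_ne (F : E.CKFamily B) {x : E.V} {e : E.Edge} (h : x ≠ E.r e) :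
    F.p x * F.t e = 0 := by
  rw [← F.p_mul_t e, ← mul_assoc, F.p_mul_p _ _ h, zero_mul]

/-- By the C⋆-identity: `d = t_e p - t_e` with `p = t_e⋆ t_e` satisfies `d⋆ d = 0`. -/
theorem t_mul_p (F : E.CKFamily B) (e : E.Edge) : F.t e * F.p (E.s e) = F.t e := by
  rw [← sub_eq_zero, ← CStarRing.star_mul_self_eq_zero_iff, ← F.star_t_mul_self e]
  simp only [star_sub, star_mul, star_star, sub_mul, mul_sub, mul_assoc]
  simp only [← mul_assoc (star (F.t e)) (F.t e), F.star_t_mul_self, F.p_mul_self, sub_self]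

theorem star_t_mul_p (F : E.CKFamily B) (e : E.Edge) :
    star (F.t e) * F.p (E.r e) = star (F.t e) := by
  rw [← F.star_p, ← star_mul, F.p_mul_t]

theorem star_t_mul_p_of_ne (F : E.CKFamily B) {x : E.V} {e : E.Edge} (h : x ≠ E.r e) :
    star (F.t e) * F.p x = 0 := by
  rw [← F.star_p, ← star_mul, F.p_mul_t_of_ne h, star_zero]

theorem word_mul_p (F : E.CKFamily B) (x : E.V) (μ : List E.Edge) :
    F.word x μ * F.p x = F.word x μ := by
  induction μ with
  | nil => exact F.p_mul_self x
  | cons e μ ih => rw [word, mul_assoc, ih]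

theorem word_append_singleton (F : E.CKFamily B) (e : E.Edge) (μ : List E.Edge) :
    F.word (E.s e) (μ ++ [e]) = F.word (E.r e) μ * F.t e := by
  induction μ with
  | nil => simp [word, F.t_mul_p, F.p_mul_t]
  | cons f μ ih => rw [List.cons_append, word, ih, word, mul_assoc]

theorem p_mul_word_cons (F : E.CKFamily B) (x : E.V) (e : E.Edge) (μ : List E.Edge) :
    F.p (E.r e) * F.word x (e :: μ) = F.word x (e :: μ) := by
  rw [word, ← mul_assoc, F.p_mul_t]

theorem p_mul_word_cons_of_ne (F : E.CKFamily B) {y : E.V} (x : E.V) {e : E.Edge}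
    (μ : List E.Edge) (h : y ≠ E.r e) : F.p y * F.word x (e :: μ) = 0 := by
  rw [word, ← mul_assoc, F.p_mul_t_of_ne h, zero_mul]

theorem p_mul_word_eq_zero_or (F : E.CKFamily B) (y x : E.V) (μ : List E.Edge) :
    F.p y * F.word x μ = 0 ∨ F.p y * F.word x μ = F.word x μ := by
  cases μ with
  | nil =>
    by_cases h : y = x
    · exact Or.inr (h ▸ F.p_mul_self y)
    · exact Or.inl (F.p_mul_p y x h)
  | cons e μ =>
    by_cases h : y = E.r e
    · exact Or.inr (h ▸ F.p_mul_word_cons x e μ)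
    · exact Or.inl (F.p_mul_word_cons_of_ne x μ h)

theorem star_word_cons_mul_word_cons (F : E.CKFamily B) (x y : E.V) (e : E.Edge)
    (ν μ : List E.Edge) :
    star (F.word y (e :: ν)) * F.word x (e :: μ) =
      star (F.word y ν) * (F.p (E.s e) * F.word x μ) := by
  rw [word, word, star_mul, mul_assoc, ← mul_assoc (star (F.t e)), F.star_t_mul_self]

theorem star_word_cons_mul_word_cons_of_ne (F : E.CKFamily B) (x y : E.V) {e f : E.Edge}
    (h : e ≠ f) (ν μ : List E.Edge) :
    star (F.word y (e :: ν)) * F.word x (f :: μ) = 0 := by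
  rw [word, word, star_mul, mul_assoc, ← mul_assoc (star (F.t e)), F.star_t_mul_t e f h,
    zero_mul, mul_zero]

/-- Words of equal length that differ do so at some first position, where `t_e⋆ t_f = 0`. -/
theorem star_word_mul_word_of_ne (F : E.CKFamily B) (x y : E.V) {ν μ : List E.Edge}
    (hlen : ν.length = μ.length) (hne : ν ≠ μ) : star (F.word y ν) * F.word x μ = 0 := by
  induction ν generalizing μ with
  | nil => exact absurd (List.length_eq_zero_iff.1 hlen.symm).symm hne
  | cons e ν ih =>
    cases μ with
    | nil => simp at hlen
    | cons f μ =>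
      by_cases hef : e = f
      · subst hef
        rw [F.star_word_cons_mul_word_cons]
        rcases F.p_mul_word_eq_zero_or (E.s e) x μ with h | h
        · rw [h, mul_zero]
        · rw [h]
          exact ih (by simpa using hlen) fun h => hne (by rw [h])
      · exact F.star_word_cons_mul_word_cons_of_ne x y hef ν μ

/-- For a path `μ` with source `x`, the element `t_μ p_x` is a partial isometry with initial
projection `p_x`. -/
theorem star_word_mul_self (F : E.CKFamily B) {x : E.V} {μ : List E.Edge} (hμ : E.IsPath μ)
    (hx : ∀ h : μ ≠ [], E.s (μ.getLast h) = x) : star (F.word x μ) * F.word x μ = F.p x := by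
  induction μ with
  | nil => rw [word, F.star_p, F.p_mul_self]
  | cons e μ ih =>
    rw [F.star_word_cons_mul_word_cons]
    cases μ with
    | nil =>
      have h : E.s e = x := hx (by simp)
      rw [word, h, F.p_mul_self, F.star_p, F.p_mul_self]
    | cons f μ =>
      obtain ⟨hef, hμ'⟩ := List.isChain_cons_cons.1 hμ
      rw [hef, F.p_mul_word_cons]
      exact ih hμ' fun h => by simpa using hx (by simp)

theorem isPath_of_word_ne_zero (F : E.CKFamily B) {x : E.V} {μ : List E.Edge}
    (h0 : F.word x μ ≠ 0) : E.IsPath μ ∧ ∀ h : μ ≠ [], E.s (μ.getLast h) = x := by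
  induction μ with
  | nil => exact ⟨List.isChain_nil, fun h => absurd rfl h⟩
  | cons e μ ih =>
    have hs : F.word x (e :: μ) = F.t e * (F.p (E.s e) * F.word x μ) := by
      rw [← mul_assoc, F.t_mul_p, word]
    cases μ with
    | nil =>
      refine ⟨List.isChain_singleton e, fun _ => ?_⟩
      by_contra hne
      exact h0 (by rw [hs, word, F.p_mul_p (E.s e) x hne, mul_zero])
    | cons f μ =>
      have hef : E.s e = E.r f := by
        by_contra hne
        exact h0 (by rw [hs, F.p_mul_word_cons_of_ne x μ hne, mul_zero])
      obtain ⟨hp, hl⟩ := ih fun h => h0 (by rw [word, h, mul_zero])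
      exact ⟨List.isChain_cons_cons.2 ⟨hef, hp⟩, fun _ => by simpa using hl (by simp)⟩

theorem isCycleAt_of_p_mul_word_ne_zero (F : E.CKFamily B) {x : E.V} {μ : List E.Edge}
    (hμ : μ ≠ []) (h0 : F.p x * F.word x μ ≠ 0) : E.IsCycleAt x μ := by
  obtain ⟨hp, hl⟩ := F.isPath_of_word_ne_zero fun h => h0 (by rw [h, mul_zero])
  refine ⟨hp, hμ, hl hμ, ?_⟩
  cases μ with
  | nil => exact absurd rfl hμ
  | cons e μ =>
    by_contra hne
    exact h0 (F.p_mul_word_cons_of_ne _ μ (Ne.symm hne))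

theorem p_mul_word_of_isCycleAt (F : E.CKFamily B) {x : E.V} {μ : List E.Edge}
    (h : E.IsCycleAt x μ) : F.p x * F.word x μ = F.word x μ := by
  obtain ⟨-, h0, -, hr⟩ := h
  cases μ with
  | nil => exact absurd rfl h0
  | cons e μ =>
    obtain rfl : E.r e = x := hr
    exact F.p_mul_word_cons _ e μ

/-- The monomials `t_μ p_x t_ν⋆`, together with `0`. -/
def monomials (F : E.CKFamily B) : Set B :=
  insert 0 {a | ∃ μ x ν, a = F.word x μ * star (F.word x ν)}

theorem word_mul_star_word_mem_monomials (F : E.CKFamily B) (x : E.V) (μ ν : List E.Edge) :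
    F.word x μ * star (F.word x ν) ∈ F.monomials :=
  Or.inr ⟨μ, x, ν, rfl⟩

theorem p_mem_monomials (F : E.CKFamily B) (x : E.V) : F.p x ∈ F.monomials := by
  simpa [word, F.star_p, F.p_mul_self] using F.word_mul_star_word_mem_monomials x [] []

theorem t_mem_monomials (F : E.CKFamily B) (e : E.Edge) : F.t e ∈ F.monomials := by
  simpa [word, F.star_p, F.t_mul_p] using F.word_mul_star_word_mem_monomials (E.s e) [e] []

theorem star_mem_monomials (F : E.CKFamily B) {a : B} (ha : a ∈ F.monomials) :
    star a ∈ F.monomials := by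
  rcases ha with rfl | ⟨μ, x, ν, rfl⟩
  · exact Or.inl (star_zero _)
  · rw [star_mul, star_star]
    exact F.word_mul_star_word_mem_monomials x ν μ

theorem p_mul_mem_monomials (F : E.CKFamily B) (y : E.V) {a : B} (ha : a ∈ F.monomials) :
    F.p y * a ∈ F.monomials := by
  rcases ha with rfl | ⟨μ, x, ν, rfl⟩
  · exact Or.inl (mul_zero _)
  · rw [← mul_assoc]
    rcases F.p_mul_word_eq_zero_or y x μ with h | h
    · exact Or.inl (by rw [h, zero_mul])
    · rw [h]
      exact F.word_mul_star_word_mem_monomials x μ ν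

theorem t_mul_mem_monomials (F : E.CKFamily B) (e : E.Edge) {a : B} (ha : a ∈ F.monomials) :
    F.t e * a ∈ F.monomials := by
  rcases ha with rfl | ⟨μ, x, ν, rfl⟩
  · exact Or.inl (mul_zero _)
  · rw [← mul_assoc]
    exact F.word_mul_star_word_mem_monomials x (e :: μ) ν

/-- Either `t_e⋆` meets the first edge of `μ`, cancelling it or giving zero, or `μ` is empty and `e`
is appended to `ν` with the source moved to `s e`. -/
theorem star_t_mul_mem_monomials (F : E.CKFamily B) (e : E.Edge) {a : B}
    (ha : a ∈ F.monomials) : star (F.t e) * a ∈ F.monomials := by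
  rcases ha with rfl | ⟨μ, x, ν, rfl⟩
  · exact Or.inl (mul_zero _)
  · cases μ with
    | nil =>
      by_cases h : x = E.r e
      · subst h
        have : star (F.t e) * (F.word (E.r e) [] * star (F.word (E.r e) ν)) =
            F.word (E.s e) [] * star (F.word (E.s e) (ν ++ [e])) := by
          rw [word, word, ← mul_assoc, F.star_t_mul_p, F.word_append_singleton, star_mul,
            ← mul_assoc]
          congr 1
          rw [← F.star_p (E.s e), ← star_mul, F.t_mul_p]
        rw [this]
        exact F.word_mul_star_word_mem_monomials _ _ _
      · exact Or.inl (by rw [word, ← mul_assoc, F.star_t_mul_p_of_ne h, zero_mul])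
    | cons f μ =>
      by_cases h : e = f
      · subst h
        rw [word, ← mul_assoc, ← mul_assoc, F.star_t_mul_self, mul_assoc]
        exact F.p_mul_mem_monomials _ (F.word_mul_star_word_mem_monomials x μ ν)
      · exact Or.inl (by
          rw [word, ← mul_assoc, ← mul_assoc, F.star_t_mul_t e f h, zero_mul, zero_mul])

/-- The ⋆-algebra generated by a Cuntz–Krieger family is spanned by the monomials
`t_μ p_x t_ν⋆`. -/
theorem adjoin_le_span_monomials (F : E.CKFamily B) {a : B}
    (ha : a ∈ NonUnitalStarAlgebra.adjoin ℂ (Set.range F.p ∪ Set.range F.t)) :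
    a ∈ Submodule.span ℂ F.monomials := by
  -- Stability under left multiplication is carried along, so that only products of a generator with
  -- a monomial need computing.
  have hmul : ∀ b ∈ Subsemigroup.closure ((Set.range F.p ∪ Set.range F.t) ∪
      star (Set.range F.p ∪ Set.range F.t)), b ∈ F.monomials ∧
      ∀ c ∈ F.monomials, b * c ∈ F.monomials := by
    intro b hb
    induction hb using Subsemigroup.closure_induction with
    | mem b hb =>
      rcases hb with (⟨x, rfl⟩ | ⟨e, rfl⟩) | (⟨x, hx⟩ | ⟨e, he⟩)
      · exact ⟨F.p_mem_monomials x, fun c hc => F.p_mul_mem_monomials x hc⟩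
      · exact ⟨F.t_mem_monomials e, fun c hc => F.t_mul_mem_monomials e hc⟩
      · obtain rfl : b = F.p x := by rw [← star_star b, ← hx, F.star_p]
        exact ⟨F.p_mem_monomials x, fun c hc => F.p_mul_mem_monomials x hc⟩
      · obtain rfl : b = star (F.t e) := by rw [he, star_star]
        exact ⟨F.star_mem_monomials (F.t_mem_monomials e),
          fun c hc => F.star_t_mul_mem_monomials e hc⟩
    | mul b c _ _ hb hc =>
      refine ⟨hb.2 c hc.1, fun d hd => ?_⟩
      rw [mul_assoc]
      exact hb.2 _ (hc.2 d hd)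
  have ha' : a ∈ NonUnitalAlgebra.adjoin ℂ ((Set.range F.p ∪ Set.range F.t) ∪
      star (Set.range F.p ∪ Set.range F.t)) := ha
  rw [← NonUnitalSubalgebra.mem_toSubmodule, NonUnitalAlgebra.adjoin_eq_span] at ha'
  exact Submodule.span_mono (fun b hb => (hmul b hb).1) ha'

end CKFamily

end DiscreteGraph

/-! ### Tracial states -/

namespace IsTracialState

variable {A : Type w} [NonUnitalCStarAlgebra A] {τ : A →L[ℂ] ℂ}

theorem eq_zero_of_forall_nonneg {u c : ℂ} (h : ∀ t : ℝ, 0 ≤ (t : ℂ) * u + (t : ℂ) ^ 2 * c) :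
    u = 0 := by
  have him : ∀ t : ℝ, 0 = t * u.im + t ^ 2 * c.im := fun t => by
    simpa [← Complex.ofReal_pow] using (Complex.le_def.1 (h t)).2
  have hre : ∀ t : ℝ, 0 ≤ t * u.re + t ^ 2 * c.re := fun t => by
    simpa [← Complex.ofReal_pow] using (Complex.le_def.1 (h t)).1
  refine Complex.ext ?_ ?_
  · have hc : 0 < |c.re| + 1 := by positivity
    -- For this small `t` of sign opposite to `u.re`, the linear term outweighs the quadratic one.
    have h1 := hre (-u.re / (|c.re| + 1))
    have h2 : -u.re / (|c.re| + 1) * u.re + (-u.re / (|c.re| + 1)) ^ 2 * c.re =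
        u.re ^ 2 * (c.re - (|c.re| + 1)) / (|c.re| + 1) ^ 2 := by
      field_simp
      ring
    rw [h2, le_div_iff₀ (by positivity), zero_mul] at h1
    have h3 : c.re ≤ |c.re| := le_abs_self _
    have h4 : u.re ^ 2 = 0 := by nlinarith [sq_nonneg u.re]
    simpa using h4
  · have h1 := him 1
    have h2 := him (-1)
    simp only [Complex.zero_im]
    linarith

/-- The null vectors of a tracial state: if `τ (a⋆ a) = 0` then `τ (a⋆ b) = 0`. -/
theorem map_star_mul_eq_zero (hτ : IsTracialState τ) {a : A} (ha : τ (star a * a) = 0) (b : A) :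
    τ (star a * b) = 0 := by
  -- This is the first-order term in `t` of the positive quantity `τ ((a + t c b)⋆ (a + t c b))`,
  -- whose constant term vanishes. Taking `c = 1` and `c = I` separates the two summands.
  have key : ∀ c : ℂ, c * τ (star a * b) + star c * τ (star b * a) = 0 := fun c => by
    refine eq_zero_of_forall_nonneg (c := c * star c * τ (star b * b)) fun t => ?_
    have h := hτ.nonneg (a + ((t : ℂ) * c) • b)
    have h' : star (a + ((t : ℂ) * c) • b) * (a + ((t : ℂ) * c) • b) =
        star a * a + ((t : ℂ) * c) • (star a * b) + ((t : ℂ) * star c) • (star b * a) +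
          ((t : ℂ) ^ 2 * (c * star c)) • (star b * b) := by
      have : star (t : ℂ) = t := Complex.conj_ofReal t
      rw [show (t : ℂ) ^ 2 * (c * star c) = ((t : ℂ) * c) * ((t : ℂ) * star c) by ring]
      simp only [star_add, star_smul, add_mul, mul_add, smul_mul_assoc, mul_smul_comm,
        this, smul_add, mul_smul]
      abel
    rw [h', map_add, map_add, map_add, map_smul, map_smul, map_smul, ha] at h
    simp only [smul_eq_mul] at h
    convert h using 1
    ring
  have h1 := key 1
  have hI := key Complex.I
  simp only [star_one, one_mul] at h1
  have hI' : star Complex.I = -Complex.I := Complex.conj_I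
  rw [hI'] at hI
  have h2 : τ (star a * b) - τ (star b * a) = 0 := by
    have : Complex.I * (τ (star a * b) - τ (star b * a)) = 0 := by linear_combination hI
    simpa using this
  linear_combination (h1 + h2) / 2

/-- A projection with two orthogonal subprojections equivalent to it has trace zero. -/
theorem map_eq_zero_of_partialIsometries (hτ : IsTracialState τ) {p a b : A} (hp : star p = p)
    (hpp : p * p = p) (ha : star a * a = p) (hb : star b * b = p) (hab : star a * b = 0)
    (hpa : p * a = a) (hpb : p * b = b) (hap : a * p = a) (hbp : b * p = b) : τ p = 0 := by
  have hba : star b * a = 0 := by rw [← star_star a, ← star_mul, hab, star_zero]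
  have hap' : star a * p = star a := by rw [← hp, ← star_mul, hpa]
  have hbp' : star b * p = star b := by rw [← hp, ← star_mul, hpb]
  -- The remainder `d` is a projection with `τ d = τ p - 2 τ p = -τ p`, so positivity forces `τ p ≤
  -- 0`.
  set d := p - a * star a - b * star b with hd
  have hdd : star d * d = d := by
    have hs : star d = d := by simp [hd, hp]
    have haa : a * star a * (a * star a) = a * star a := by
      rw [mul_assoc, ← mul_assoc (star a), ha, ← mul_assoc, hap]
    have hbb : b * star b * (b * star b) = b * star b := by
      rw [mul_assoc, ← mul_assoc (star b), hb, ← mul_assoc, hbp]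
    have h1 : a * star a * (b * star b) = 0 := by
      rw [mul_assoc, ← mul_assoc (star a), hab, zero_mul, mul_zero]
    have h2 : b * star b * (a * star a) = 0 := by
      rw [mul_assoc, ← mul_assoc (star b), hba, zero_mul, mul_zero]
    rw [hs, hd]
    simp only [sub_mul, mul_sub, hpp, haa, hbb, h1, h2, ← mul_assoc p, hpa, hpb]
    simp only [mul_assoc, hap', hbp']
    abel
  have h1 := hτ.nonneg d
  have h2 := hτ.nonneg p
  rw [hdd, hd, map_sub, map_sub, hτ.map_mul_comm a, hτ.map_mul_comm b, ha, hb] at h1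
  rw [hp, hpp] at h2
  refine le_antisymm ?_ h2
  have h3 : 0 ≤ -τ p := by
    convert h1 using 1
    ring
  exact neg_nonneg.1 h3

end IsTracialState

namespace DiscreteGraph

/-! ### Vanishing of traces under condition (K) -/

variable {E : DiscreteGraph.{u, v}}

/-- Under condition (K), a tracial functional vanishes on vertices that lie on a cycle. -/
theorem ConditionK.tracial_map_p_eq_zero (hK : E.ConditionK) {A : Type w}
    [NonUnitalCStarAlgebra A] (F : E.CKFamily A) {τ : A →L[ℂ] ℂ} (hτ : IsTracialState τ)
    {x : E.V} {α : List E.Edge} (hα : E.IsCycleAt x α) : τ (F.p x) = 0 := by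
  obtain ⟨β, γ, hβ, hγ, hlen, hne⟩ := hK.exists_isCycleAt_pair hα
  exact hτ.map_eq_zero_of_partialIsometries (F.star_p x) (F.p_mul_self x)
    (F.star_word_mul_self hβ.1 fun _ => hβ.2.2.1) (F.star_word_mul_self hγ.1 fun _ => hγ.2.2.1)
    (F.star_word_mul_word_of_ne x x hlen hne) (F.p_mul_word_of_isCycleAt hβ)
    (F.p_mul_word_of_isCycleAt hγ) (F.word_mul_p x β) (F.word_mul_p x γ)

theorem ConditionK.tracial_map_p_mul_word_mul_eq_zero (hK : E.ConditionK) {A : Type w}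
    [NonUnitalCStarAlgebra A] (F : E.CKFamily A) {τ : A →L[ℂ] ℂ} (hτ : IsTracialState τ)
    (x : E.V) {μ : List E.Edge} (hμ : μ ≠ []) :
    τ (F.p x * F.word x μ) = 0 ∧ τ (star (F.word x μ) * F.p x) = 0 := by
  by_cases h0 : F.p x * F.word x μ = 0
  · refine ⟨by rw [h0, map_zero], ?_⟩
    rw [← F.star_p x, ← star_mul, h0, star_zero, map_zero]
  · have hp := hK.tracial_map_p_eq_zero F hτ (F.isCycleAt_of_p_mul_word_ne_zero hμ h0)
    have h : ∀ b, τ (F.p x * b) = 0 := fun b => by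
      have := hτ.map_star_mul_eq_zero (a := F.p x) (by rw [F.star_p, F.p_mul_self, hp]) b
      rwa [F.star_p] at this
    exact ⟨h _, by rw [hτ.map_mul_comm, h]⟩

/-- Stripping equal first edges preserves the difference in length, so one word runs out first. Both
words carry the same `p_x`, so what remains is compressed by `p_x` on both sides. -/
theorem ConditionK.tracial_map_star_word_mul_word_eq_zero (hK : E.ConditionK) {A : Type w}
    [NonUnitalCStarAlgebra A] (F : E.CKFamily A) {τ : A →L[ℂ] ℂ} (hτ : IsTracialState τ)
    (x : E.V) {ν μ : List E.Edge} (hlen : ν.length ≠ μ.length) :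
    τ (star (F.word x ν) * F.word x μ) = 0 := by
  induction ν generalizing μ with
  | nil =>
    have hμ : μ ≠ [] := by
      rintro rfl
      exact hlen rfl
    rw [CKFamily.word, F.star_p]
    exact (hK.tracial_map_p_mul_word_mul_eq_zero F hτ x hμ).1
  | cons e ν ih =>
    cases μ with
    | nil => exact (hK.tracial_map_p_mul_word_mul_eq_zero F hτ x (List.cons_ne_nil e ν)).2
    | cons f μ =>
      by_cases hef : e = f
      · subst hef
        rw [F.star_word_cons_mul_word_cons]
        rcases F.p_mul_word_eq_zero_or (E.s e) x μ with h | h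
        · rw [h, mul_zero, map_zero]
        · rw [h]
          exact ih (by simpa using hlen)
      · rw [F.star_word_cons_mul_word_cons_of_ne x x hef, map_zero]

/-! ### The gauge action on monomials -/

theorem gaugeAction_word (z : Circle) (x : E.V) (μ : List E.Edge) :
    E.gaugeAction z (E.univFamily.word x μ) = (z : ℂ) ^ μ.length • E.univFamily.word x μ := by
  induction μ with
  | nil => simp [CKFamily.word, gaugeAction_p]
  | cons e μ ih =>
    rw [CKFamily.word, map_mul, ih, gaugeAction_t, smul_mul_smul_comm, List.length_cons, pow_succ']

theorem gaugeAction_word_mul_star_word (z : Circle) (x : E.V) {μ ν : List E.Edge}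
    (h : ν.length = μ.length) :
    E.gaugeAction z (E.univFamily.word x μ * star (E.univFamily.word x ν)) =
      E.univFamily.word x μ * star (E.univFamily.word x ν) := by
  rw [map_mul, map_star, gaugeAction_word, gaugeAction_word, star_smul, smul_mul_smul_comm, h,
    star_pow, ← mul_pow]
  simp [← Circle.coe_inv_eq_conj]

theorem continuous_gaugeAction (z : Circle) : Continuous (E.gaugeAction z) :=
  AddMonoidHomClass.continuous_of_bound (E.gaugeAction z) 1 fun a => by
    simpa using NonUnitalStarAlgHom.norm_apply_le (E.gaugeAction z) a

/-- Under condition (K), tracial states are gauge invariant on monomials. -/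
theorem ConditionK.tracial_map_gaugeAction_of_mem_monomials (hK : E.ConditionK)
    {τ : E.GraphAlgebra →L[ℂ] ℂ} (hτ : IsTracialState τ) (z : Circle) {a : E.GraphAlgebra}
    (ha : a ∈ E.univFamily.monomials) : τ (E.gaugeAction z a) = τ a := by
  rcases ha with rfl | ⟨μ, x, ν, rfl⟩
  · rw [map_zero]
  · by_cases h : ν.length = μ.length
    · rw [gaugeAction_word_mul_star_word z x h]
    · have h0 : τ (E.univFamily.word x μ * star (E.univFamily.word x ν)) = 0 := by
        rw [hτ.map_mul_comm, hK.tracial_map_star_word_mul_word_eq_zero E.univFamily hτ x h]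
      rw [map_mul, map_star, gaugeAction_word, gaugeAction_word, star_smul, smul_mul_smul_comm,
        map_smul, h0, smul_zero]

end DiscreteGraph

theorem mainTheorem8 (E : DiscreteGraph.{u, v}) (hK : E.ConditionK)
    (τ : E.GraphAlgebra →L[ℂ] ℂ) (hτ : IsTracialState τ) :
    ∀ (z : Circle) (a : E.GraphAlgebra), τ (E.gaugeAction z a) = τ a := by
  intro z a
  have ha : a ∈ (NonUnitalStarAlgebra.adjoin ℂ
      (Set.range E.univFamily.p ∪ Set.range E.univFamily.t)).topologicalClosure := by
    rw [E.topologicalClosure_adjoin_univFamily]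
    trivial
  have hclosed : IsClosed {b : E.GraphAlgebra | τ (E.gaugeAction z b) = τ b} :=
    isClosed_eq (τ.continuous.comp (DiscreteGraph.continuous_gaugeAction z)) τ.continuous
  refine closure_minimal (fun b hb => ?_) hclosed ha
  replace hb := E.univFamily.adjoin_le_span_monomials hb
  induction hb using Submodule.span_induction with
  | mem b hb => exact hK.tracial_map_gaugeAction_of_mem_monomials hτ z hb
  | zero => simp
  | add b c _ _ hb hc => simp_all
  | smul c b _ hb => simp_all
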